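/- Let $\Delta\psi(x)=\sum_{|x'-x|=1}(\psi(x')-\psi(x))$ be the lattice Laplacian on $\mathbb Z^2$, and let $H_1$ be $-\Delta$ on $\mathbb Z^2$ with the Dirichlet condition $\psi(0)=0$, that is, the bounded operator on $\ell^2(\mathbb Z^2\setminus\{0\})$ obtained by extending a function by $\psi(0)=0$, applying $-\Delta$, and restricting the result to $\mathbb Z^2\setminus\{0\}$. Let $p_1(t,x,y)$ be the kernel of $e^{-tH_1}$, with $p_1(t,x,y)=0$ if $x=0$ or $y=0$ (the transition probability of the random walk generated by $\Delta$ and annihilated at the origin). For a function $V\ge 0$ on $\mathbb Z^2$ let $N_0(V)\in\{0,1,2,\dots,\infty\}$ be the number of non-positive eigenvalues, counted with multiplicity, of the self-adjoint operator $H=-\Delta-V(x)$ in $\ell^2(\mathbb Z^2)$ with domain $\{\psi\in\ell^2(\mathbb Z^2): V\psi\in\ell^2(\mathbb Z^2)\}$. Let $|x|$ denote the Euclidean norm. Then there is an absolute constant $C>0$ such that: 1. for every $x\in\mathbb Z^2$ the Green function of $H_1$ on the diagonal is finite and $$\int_0^\infty p_1(t,x,x)\,dt\le C\ln(2+|x|);$$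 2. for every $V:\mathbb Z^2\to[0,\infty)$, $$N_0(V)\le C\sum_{x\in\mathbb Z^2}\ln(2+|x|)\,V(x)+1,$$ where the right-hand side is understood as $+\infty$ if the series diverges. -/

import Mathlib

noncomputable section

namespace LatticeSchrodinger

/-- The lattice `Z²`. -/
abbrev Z2 : Type := ℤ × ℤ

/-- The Euclidean norm `|x|` of a lattice point. -/
def eNorm (x : Z2) : ℝ := Real.sqrt ((x.1 : ℝ) ^ 2 + (x.2 : ℝ) ^ 2)

/-- The Hilbert space of square summable functions on `α` with values in `𝕜`. -/
abbrev L2 (𝕜 : Type) [RCLike 𝕜] (α : Type) : Type := lp (fun _ : α => 𝕜) 2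

/-- The lattice Laplacian on functions, `(Δψ)(x) = ∑_{|x' - x| = 1} (ψ(x') - ψ(x))`; the four
lattice points at Euclidean distance `1` from `x` are written out. -/
def laplacian {𝕜 : Type} [RCLike 𝕜] (ψ : Z2 → 𝕜) (x : Z2) : 𝕜 :=
  (ψ (x + (1, 0)) - ψ x) + (ψ (x + (-1, 0)) - ψ x)
    + (ψ (x + (0, 1)) - ψ x) + (ψ (x + (0, -1)) - ψ x)

section Operators

variable (𝕜 : Type) [RCLike 𝕜]

theorem sum_comp_le {α β : Type} (f : α → β) (hf : Function.Injective f) (ψ : L2 𝕜 β)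
    (s : Finset α) :
    ∑ i ∈ s, ‖ψ (f i)‖ ^ (2 : ENNReal).toReal ≤ ‖ψ‖ ^ (2 : ENNReal).toReal := by
  classical
  have h := lp.sum_rpow_le_norm_rpow (p := 2) (by norm_num) ψ (s.image f)
  rwa [Finset.sum_image (fun a _ b _ hab => hf hab)] at h

/-- Composition `ψ ↦ ψ ∘ f` with an injective map `f`, as a bounded operator of `ℓ²` spaces. -/
def compOp {α β : Type} (f : α → β) (hf : Function.Injective f) : L2 𝕜 β →L[𝕜] L2 𝕜 α :=
  LinearMap.mkContinuous
    { toFun := fun ψ => ⟨fun i => ψ (f i), memℓp_gen' (sum_comp_le 𝕜 f hf ψ)⟩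
      map_add' := fun _ _ => rfl
      map_smul' := fun _ _ => rfl }
    1
    (fun ψ => lp.norm_le_of_forall_sum_le (by norm_num) (by positivity) (by
      intro s
      rw [one_mul]
      exact sum_comp_le 𝕜 f hf ψ s))

@[simp]
theorem compOp_apply {α β : Type} (f : α → β) (hf : Function.Injective f) (ψ : L2 𝕜 β) (i : α) :
    compOp 𝕜 f hf ψ i = ψ (f i) := rfl

/-- Translation `(S_e ψ)(x) = ψ(x + e)` on `ℓ²(Z²)`. -/
def shift (e : Z2) : L2 𝕜 Z2 →L[𝕜] L2 𝕜 Z2 :=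
  compOp 𝕜 (fun x => x + e) (add_left_injective e)

/-- The unperturbed operator `H₀ = -Δ` on `ℓ²(Z²)` (a bounded operator). -/
def freeOp : L2 𝕜 Z2 →L[𝕜] L2 𝕜 Z2 :=
  -((shift 𝕜 (1, 0) - 1) + (shift 𝕜 (-1, 0) - 1) + (shift 𝕜 (0, 1) - 1) + (shift 𝕜 (0, -1) - 1))

/-- `H₀` acts as the negative lattice Laplacian. -/
theorem freeOp_apply (ψ : L2 𝕜 Z2) (x : Z2) : freeOp 𝕜 ψ x = -laplacian (⇑ψ) x := rfl

/-- The lattice without the origin. -/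
abbrev Punctured : Type := {x : Z2 // x ≠ 0}

/-- Restriction `ℓ²(Z²) → ℓ²(Z² \ {0})`. -/
def restrictOp : L2 𝕜 Z2 →L[𝕜] L2 𝕜 Punctured :=
  compOp 𝕜 Subtype.val Subtype.val_injective

/-- Extension by zero `ℓ²(Z² \ {0}) → ℓ²(Z²)`, the adjoint of the restriction. -/
def extendOp : L2 𝕜 Punctured →L[𝕜] L2 𝕜 Z2 :=
  ContinuousLinearMap.adjoint (restrictOp 𝕜)

theorem extendOp_apply (ψ : L2 𝕜 Punctured) (x : Z2) :
    extendOp 𝕜 ψ x = if hx : x ≠ 0 then ψ ⟨x, hx⟩ else 0 := by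
  have h1 : inner 𝕜 (lp.single 2 x (1 : 𝕜)) (extendOp 𝕜 ψ) = extendOp 𝕜 ψ x := by
    rw [lp.inner_single_left]; simp
  rw [← h1, extendOp, ContinuousLinearMap.adjoint_inner_right]
  split_ifs with hx
  · have h2 : restrictOp 𝕜 (lp.single 2 x (1 : 𝕜)) = lp.single 2 (⟨x, hx⟩ : Punctured) (1 : 𝕜) := by
      ext i
      by_cases hi : i = ⟨x, hx⟩
      · subst hi; simp [restrictOp]
      · have hi' : i.1 ≠ x := fun h => hi (Subtype.ext h)
        simp [restrictOp, hi, hi']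
    rw [h2, lp.inner_single_left]; simp
  · have h2 : restrictOp 𝕜 (lp.single 2 x (1 : 𝕜)) = 0 := by
      ext i
      have hi' : i.1 ≠ x := fun h => hx (h ▸ i.2)
      simp [restrictOp, hi']
    rw [h2, inner_zero_left]

/-- The operator `H₁`: the negative lattice Laplacian with the Dirichlet condition `ψ(0) = 0`,
i.e. `-Δ` applied to functions on `Z² \ {0}` that are extended by `ψ(0) = 0`. -/
def dirichletOp : L2 𝕜 Punctured →L[𝕜] L2 𝕜 Punctured :=
  restrictOp 𝕜 ∘L freeOp 𝕜 ∘L extendOp 𝕜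

end Operators

/-- The kernel `p₁(t, x, y)` of the semigroup `exp (-t H₁)`, i.e. the solution of
`dp₁/dt = -H₁ p₁`, `p₁(0, x, y) = δ_y(x)`. It is the transition probability of the random walk on
`Z²` generated by `Δ` and annihilated at the origin; it is `0` if `x = 0` or `y = 0`. -/
def heatKernel (t : ℝ) (x y : Z2) : ℝ :=
  extendOp ℝ (NormedSpace.exp (-(t • dirichletOp ℝ)) (restrictOp ℝ (lp.single 2 y (1 : ℝ)))) x

/-- The (possibly unbounded) self-adjoint Schrödinger operator `H = -Δ - V(x)` in `ℓ²(Z²)`, with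
the natural domain `{ψ ∈ ℓ² : V ψ ∈ ℓ²}` (which is all of `ℓ²` if `V` is bounded). -/
def schrodinger (V : Z2 → ℝ) : L2 ℂ Z2 →ₗ.[ℂ] L2 ℂ Z2 where
  domain :=
    { carrier := {ψ | Memℓp (fun x => (V x : ℂ) * ψ x) 2}
      zero_mem' := by
        have h : (fun x : Z2 => (V x : ℂ) * (0 : L2 ℂ Z2) x) = 0 := by ext x; simp
        simp only [Set.mem_ofPred_eq]
        rw [h]; exact zero_memℓp
      add_mem' := by
        intro a b ha hb
        have h : (fun x : Z2 => (V x : ℂ) * (a + b) x)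
            = (fun x => (V x : ℂ) * a x) + fun x => (V x : ℂ) * b x := by
          ext x; simp [mul_add]
        simp only [Set.mem_ofPred_eq] at ha hb ⊢
        rw [h]; exact ha.add hb
      smul_mem' := by
        intro c a ha
        have h : (fun x : Z2 => (V x : ℂ) * (c • a) x) = c • fun x => (V x : ℂ) * a x := by
          ext x; simp [mul_left_comm]
        simp only [Set.mem_ofPred_eq] at ha ⊢
        rw [h]; exact ha.const_smul c }
  toFun :=
    { toFun := fun ψ => freeOp ℂ ψ.1 - ⟨fun x => (V x : ℂ) * ψ.1 x, ψ.2⟩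
      map_add' := by
        intro a b; ext x
        change freeOp ℂ (a.1 + b.1) x - (V x : ℂ) * (a.1 x + b.1 x)
          = (freeOp ℂ a.1 x - (V x : ℂ) * a.1 x) + (freeOp ℂ b.1 x - (V x : ℂ) * b.1 x)
        rw [map_add, lp.coeFn_add, Pi.add_apply]; ring
      map_smul' := by
        intro c a; ext x
        change freeOp ℂ (c • a.1) x - (V x : ℂ) * (c * a.1 x)
          = c * (freeOp ℂ a.1 x - (V x : ℂ) * a.1 x)
        rw [map_smul, lp.coeFn_smul, Pi.smul_apply, smul_eq_mul]; ring }

theorem schrodinger_apply (V : Z2 → ℝ) (ψ : (schrodinger V).domain) (x : Z2) :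
    schrodinger V ψ x = -laplacian (⇑ψ.1) x - (V x : ℂ) * ψ.1 x := rfl

/-- The space of solutions of `H ψ = E ψ` in the domain of `H`. -/
def eigenspace (V : Z2 → ℝ) (E : ℝ) : Submodule ℂ (schrodinger V).domain :=
  LinearMap.ker ((schrodinger V).toFun - (E : ℂ) • (schrodinger V).domain.subtype)

theorem mem_eigenspace (V : Z2 → ℝ) (E : ℝ) (ψ : (schrodinger V).domain) :
    ψ ∈ eigenspace V E ↔
      ∀ x, -laplacian (⇑ψ.1) x - (V x : ℂ) * ψ.1 x = (E : ℂ) * ψ.1 x := by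
  rw [eigenspace, LinearMap.mem_ker, LinearMap.sub_apply, sub_eq_zero, lp.ext_iff, funext_iff]
  rfl

/-- `N₀(V) = #{λⱼ ≤ 0}`: the number of non-positive eigenvalues of `H = -Δ - V`, each counted with
its multiplicity (a number in `{0, 1, 2, …, ∞}`). -/
def numNonpos (V : Z2 → ℝ) : ENNReal :=
  ∑' E : Set.Iic (0 : ℝ), ((Cardinal.toENat (Module.rank ℂ (eigenspace V E)) : ℕ∞) : ENNReal)

end LatticeSchrodinger

end

open LatticeSchrodinger

/-! Both parts follow from one estimate, the logarithmic growth of effective resistance in the plane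
(`EnergyLe.norm_sub_sq_le`): `|ψ(x) - ψ(0)|² ≤ 208 ln(2 + |x|) ‖∇ψ‖²`. To prove it along the axis,
`ψ(0)` is compared with the averages of `ψ` over the columns `{n} × {0, …, n}`. Passing from column
`n` to column `n + 1` costs at most `2/(n + 1)` times the energy of edges used only at that step, so
Cauchy–Schwarz produces a harmonic sum.

Green function: for `u = ∫₀ᵀ exp(-tH₁) δ_x dt` one has `⟪H₁ u, u⟫ ≤ ⟪δ_x, u⟫ = u(x)`. The resistance
bound then reads `u(x)² ≤ K u(x)`, so `u(x) ≤ K` uniformly in `T`.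

Counting: on the span of eigenvectors with `E ≤ 0` one has `‖∇ψ‖² ≤ ∑ V|ψ|²`. The condition `ψ(0) =
0` costs at most one dimension, the `+1`. On what remains choose a basis `φ_i` orthonormal for the
energy. The resistance bound gives `∑_i |φ_i(x)|² ≤ K(x)`, and summing the form inequality over `i`
bounds the dimension by `∑ V(x) K(x)`. -/

namespace LatticeSchrodinger

/-! ### Logarithmic bound for the effective resistance of the lattice. -/

section Resistance

variable {𝕜 : Type} [RCLike 𝕜]

/-- The Dirichlet energy of `ψ` is at most `B`. -/
def EnergyLe (ψ : Z2 → 𝕜) (B : ℝ) : Prop :=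
  ∀ s t : Finset Z2,
    ∑ x ∈ s, ‖ψ (x + (1, 0)) - ψ x‖ ^ 2 + ∑ x ∈ t, ‖ψ (x + (0, 1)) - ψ x‖ ^ 2 ≤ B

theorem EnergyLe.nonneg {ψ : Z2 → 𝕜} {B : ℝ} (h : EnergyLe ψ B) : 0 ≤ B := by
  simpa using h ∅ ∅

theorem EnergyLe.translate {ψ : Z2 → 𝕜} {B : ℝ} (h : EnergyLe ψ B) (y : Z2) :
    EnergyLe (fun x => ψ (x + y)) B := by
  intro s t
  have := h (s.map (addRightEmbedding y)) (t.map (addRightEmbedding y))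
  simpa [Finset.sum_map, add_right_comm] using this

theorem EnergyLe.swap {ψ : Z2 → 𝕜} {B : ℝ} (h : EnergyLe ψ B) :
    EnergyLe (fun x => ψ x.swap) B := by
  intro s t
  have := h (t.map (Equiv.prodComm ℤ ℤ).toEmbedding) (s.map (Equiv.prodComm ℤ ℤ).toEmbedding)
  rw [add_comm] at this
  simpa [Finset.sum_map, Prod.swap_add] using this

theorem EnergyLe.reflect {ψ : Z2 → 𝕜} {B : ℝ} (h : EnergyLe ψ B) :
    EnergyLe (fun x => ψ (-x.1, x.2)) B := by
  intro s t
  let r : Z2 ≃ Z2 := (Equiv.neg ℤ).prodCongr (Equiv.refl ℤ)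
  have := h (s.map (r.toEmbedding.trans (addRightEmbedding (-1, 0)))) (t.map r.toEmbedding)
  simp only [Finset.sum_map] at this
  refine le_trans (le_of_eq ?_) this
  congr 1
  · refine Finset.sum_congr rfl fun x _ => ?_
    rw [norm_sub_rev]
    change _ = ‖ψ (-x.1 + -1 + 1, x.2 + 0 + 0) - ψ (-x.1 + -1, x.2 + 0)‖ ^ 2
    simp [add_comm]
  · refine Finset.sum_congr rfl fun x _ => ?_
    change _ = ‖ψ (-x.1 + 0, x.2 + 1) - ψ (-x.1, x.2)‖ ^ 2
    simp

theorem norm_sum_sq_le_card_mul {α : Type*} (s : Finset α) (f : α → 𝕜) :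
    ‖∑ i ∈ s, f i‖ ^ 2 ≤ s.card * ∑ i ∈ s, ‖f i‖ ^ 2 :=
  (pow_le_pow_left₀ (norm_nonneg _) (norm_sum_le s f) 2).trans sq_sum_le_card_mul_sum_sq

/-- The average of a function over `0, …, n`. -/
def avg (f : ℕ → 𝕜) (n : ℕ) : 𝕜 := (∑ j ∈ Finset.range (n + 1), f j) / ((n : 𝕜) + 1)

theorem norm_natCast_add_one (n : ℕ) : ‖((n : 𝕜) + 1)‖ = (n : ℝ) + 1 := by
  have := RCLike.norm_natCast (K := 𝕜) (n + 1)
  push_cast at this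
  exact this

theorem natCast_add_one_ne (n : ℕ) : ((n : 𝕜) + 1) ≠ 0 := Nat.cast_add_one_ne_zero n

theorem norm_avg_sq_le (f : ℕ → 𝕜) (n : ℕ) :
    ‖avg f n‖ ^ 2 ≤ 1 / ((n : ℝ) + 1) * ∑ j ∈ Finset.range (n + 1), ‖f j‖ ^ 2 := by
  rw [avg, norm_div, norm_natCast_add_one, div_pow, div_le_iff₀ (by positivity)]
  have := norm_sum_sq_le_card_mul (Finset.range (n + 1)) f
  rw [Finset.card_range] at this
  push_cast at this
  refine this.trans (le_of_eq ?_)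
  field_simp

theorem norm_sub_last_sq_le (f : ℕ → 𝕜) {j n : ℕ} (hj : j ≤ n) :
    ‖f n - f j‖ ^ 2 ≤ n * ∑ k ∈ Finset.range n, ‖f (k + 1) - f k‖ ^ 2 := by
  rw [← Finset.sum_Ico_sub f hj]
  refine (norm_sum_sq_le_card_mul _ _).trans ?_
  have h : ∑ k ∈ Finset.Ico j n, ‖f (k + 1) - f k‖ ^ 2 ≤
      ∑ k ∈ Finset.range n, ‖f (k + 1) - f k‖ ^ 2 := by
    apply Finset.sum_le_sum_of_subset_of_nonneg
    · intro k hk; simp at hk ⊢; omega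
    · intros; positivity
  rw [Nat.card_Ico]
  gcongr
  omega

/-- The difference of the two averages is the mean of `f (n + 1) - f j` over `j ≤ n`, divided by `n
+ 2`. Each term is at most `(n + 1) D` in square, and the division gains the factor that leaves `D /
(n + 1)`. -/
theorem norm_avg_sub_avg_succ_sq_le (f : ℕ → 𝕜) (n : ℕ) :
    ‖avg f (n + 1) - avg f n‖ ^ 2 ≤
      1 / ((n : ℝ) + 1) * ∑ k ∈ Finset.range (n + 1), ‖f (k + 1) - f k‖ ^ 2 := by
  set D := ∑ k ∈ Finset.range (n + 1), ‖f (k + 1) - f k‖ ^ 2 with hD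
  have hD0 : 0 ≤ D := by positivity
  have e : avg f (n + 1) - avg f n = avg (fun j => f (n + 1) - f j) n / ((n : 𝕜) + 1 + 1) := by
    have h1 := natCast_add_one_ne (𝕜 := 𝕜) n
    have h2 := natCast_add_one_ne (𝕜 := 𝕜) (n + 1)
    push_cast at h2
    unfold avg
    rw [Finset.sum_range_succ _ (n + 1), Finset.sum_sub_distrib]
    simp only [Finset.sum_const, Finset.card_range, nsmul_eq_mul]
    push_cast
    field_simp
    ring
  have hn2 : ‖((n : 𝕜) + 1 + 1)‖ = (n : ℝ) + 1 + 1 := by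
    have := norm_natCast_add_one (𝕜 := 𝕜) (n + 1)
    push_cast at this
    exact this
  rw [e, norm_div, hn2, div_pow, div_le_iff₀ (by positivity)]
  refine (norm_avg_sq_le _ n).trans ?_
  have h : ∑ j ∈ Finset.range (n + 1), ‖f (n + 1) - f j‖ ^ 2 ≤ ((n : ℝ) + 1) * (((n : ℝ) + 1) * D) := by
    have := Finset.sum_le_card_nsmul (Finset.range (n + 1)) (fun j => ‖f (n + 1) - f j‖ ^ 2)
      (((n + 1 : ℕ) : ℝ) * D)
      (fun j hj => norm_sub_last_sq_le f (by have := Finset.mem_range.1 hj; omega))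
    simpa using this
  have hn : (0 : ℝ) ≤ n := Nat.cast_nonneg n
  calc _ ≤ 1 / ((n : ℝ) + 1) * (((n : ℝ) + 1) * (((n : ℝ) + 1) * D)) := by gcongr
    _ = 1 / ((n : ℝ) + 1) * D * ((n : ℝ) + 1) ^ 2 := by ring
    _ ≤ _ := by gcongr; linarith

theorem norm_add_sq_le (a b : 𝕜) : ‖a + b‖ ^ 2 ≤ 2 * ‖a‖ ^ 2 + 2 * ‖b‖ ^ 2 := by
  have := pow_le_pow_left₀ (norm_nonneg _) (norm_add_le a b) 2
  nlinarith [sq_nonneg (‖a‖ - ‖b‖)]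

/-- Each step moves the average sideways at fixed height, then lengthens the column by one site.
Either move costs `1/(n + 1)` times the energy on its edges; weighted Cauchy–Schwarz over `n` gives
the harmonic number. -/
theorem norm_column_avg_sub_sq_le (g : ℕ → ℕ → 𝕜) (N : ℕ) :
    ‖avg (g N) N - g 0 0‖ ^ 2 ≤ 2 * (harmonic N : ℝ) *
      ∑ n ∈ Finset.range N, ∑ j ∈ Finset.range (n + 1),
        (‖g (n + 1) j - g n j‖ ^ 2 + ‖g (n + 1) (j + 1) - g (n + 1) j‖ ^ 2) := by
  have step (n : ℕ) : ‖avg (g (n + 1)) (n + 1) - avg (g n) n‖ ^ 2 ≤ (2 * ((n : ℝ) + 1)⁻¹) *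
      ∑ j ∈ Finset.range (n + 1),
        (‖g (n + 1) j - g n j‖ ^ 2 + ‖g (n + 1) (j + 1) - g (n + 1) j‖ ^ 2) := by
    have h1 := norm_avg_sub_avg_succ_sq_le (g (n + 1)) n
    have h2 := norm_avg_sq_le (fun j => g (n + 1) j - g n j) n
    have e : avg (fun j => g (n + 1) j - g n j) n = avg (g (n + 1)) n - avg (g n) n := by
      simp [avg, Finset.sum_sub_distrib, sub_div]
    rw [e] at h2
    have h3 := norm_add_sq_le (avg (g (n + 1)) (n + 1) - avg (g (n + 1)) n)
      (avg (g (n + 1)) n - avg (g n) n)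
    rw [sub_add_sub_cancel] at h3
    rw [Finset.sum_add_distrib, ← one_div]
    linarith
  have e0 : avg (g 0) 0 = g 0 0 := by simp [avg]
  have tel := Finset.sum_range_sub (fun n => avg (g n) n) N
  simp only [e0] at tel
  rw [← tel]
  refine (pow_le_pow_left₀ (norm_nonneg _) (norm_sum_le _ _) 2).trans ?_
  refine (Finset.sum_sq_le_sum_mul_sum_of_sq_le_mul _ (f := fun n : ℕ => 2 * ((n : ℝ) + 1)⁻¹)
    (fun _ _ => by positivity)
    (fun _ _ => by positivity) (fun n _ => step n)).trans (le_of_eq ?_)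
  rw [← Finset.mul_sum]
  simp [harmonic]

theorem EnergyLe.norm_column_avg_sub_sq_le {ψ : Z2 → 𝕜} {B : ℝ} (h : EnergyLe ψ B) (N : ℕ) :
    ‖avg (fun j => ψ ((N : ℤ), (j : ℤ))) N - ψ (0, 0)‖ ^ 2 ≤ 2 * (harmonic N : ℝ) * B := by
  refine (LatticeSchrodinger.norm_column_avg_sub_sq_le
    (fun n j => ψ ((n : ℤ), (j : ℤ))) N).trans ?_
  have hH : (0 : ℝ) ≤ harmonic N := by
    simp only [harmonic]; push_cast; positivity
  refine mul_le_mul_of_nonneg_left ?_ (by positivity)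
  -- The horizontal edges start at `(n, j)`, the vertical ones at `(n + 1, j)`, with `j ≤ n < N`. No
  -- edge occurs twice, so the total energy is at most `B`.
  let T := (Finset.range N).sigma fun n => Finset.range (n + 1)
  let i₁ : (Σ _ : ℕ, ℕ) ↪ Z2 := ⟨fun p => ((p.1 : ℤ), (p.2 : ℤ)), by
    rintro ⟨a, b⟩ ⟨c, d⟩ h; simp at h; simp [h]⟩
  let i₂ : (Σ _ : ℕ, ℕ) ↪ Z2 := ⟨fun p => ((p.1 : ℤ) + 1, (p.2 : ℤ)), by
    rintro ⟨a, b⟩ ⟨c, d⟩ h; simp at h; simp [h]⟩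
  refine le_trans (le_of_eq ?_) (h (T.map i₁) (T.map i₂))
  rw [Finset.sum_map, Finset.sum_map, ← Finset.sum_add_distrib, Finset.sum_sigma]
  refine Finset.sum_congr rfl fun n _ => Finset.sum_congr rfl fun j _ => ?_
  change _ = ‖ψ ((n : ℤ) + 1, (j : ℤ) + 0) - ψ ((n : ℤ), (j : ℤ))‖ ^ 2 +
    ‖ψ ((n : ℤ) + 1 + 0, (j : ℤ) + 1) - ψ ((n : ℤ) + 1, (j : ℤ))‖ ^ 2
  simp

/-- The same growing columns, reflected and started from `(2N, 0)`, end at the same column as those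
started from the origin, so the two points are compared through one common average. -/
theorem EnergyLe.norm_sub_even_sq_le {ψ : Z2 → 𝕜} {B : ℝ} (h : EnergyLe ψ B) (N : ℕ) :
    ‖ψ (2 * N, 0) - ψ (0, 0)‖ ^ 2 ≤ 8 * (harmonic N : ℝ) * B := by
  have h1 := h.norm_column_avg_sub_sq_le N
  have h2 := ((h.translate (2 * N, 0)).reflect).norm_column_avg_sub_sq_le N
  have e : ∀ j : ℕ, (-(N : ℤ), (j : ℤ)) + (2 * (N : ℤ), 0) = ((N : ℤ), (j : ℤ)) := by
    intro j; ext <;> simp; ring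
  simp only [e] at h2
  simp only [neg_zero, Prod.mk_add_mk, zero_add] at h2
  rw [norm_sub_rev] at h2
  have h3 := norm_add_sq_le (ψ (2 * N, 0) - avg (fun j => ψ ((N : ℤ), (j : ℤ))) N)
    (avg (fun j => ψ ((N : ℤ), (j : ℤ))) N - ψ (0, 0))
  rw [sub_add_sub_cancel] at h3
  linarith

theorem half_le_log_two_add {r : ℝ} (hr : 0 ≤ r) : 1 / 2 ≤ Real.log (2 + r) := by
  have h1 := Real.log_two_gt_d9
  have h2 : Real.log 2 ≤ Real.log (2 + r) := Real.log_le_log (by norm_num) (by linarith)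
  linarith

theorem EnergyLe.norm_sub_nat_sq_le {ψ : Z2 → 𝕜} {B : ℝ} (h : EnergyLe ψ B) (m : ℕ) :
    ‖ψ (m, 0) - ψ (0, 0)‖ ^ 2 ≤ 52 * Real.log (2 + m) * B := by
  obtain ⟨N, r, hr, rfl⟩ : ∃ N r : ℕ, r < 2 ∧ m = 2 * N + r :=
    ⟨m / 2, m % 2, by omega, by omega⟩
  have hB := h.nonneg
  have h1 := h.norm_sub_even_sq_le N
  have h2 : ‖ψ (((2 * N + r : ℕ) : ℤ), 0) - ψ (2 * N, 0)‖ ^ 2 ≤ B := by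
    interval_cases r
    · simpa using hB
    · simpa using h {(2 * (N : ℤ), 0)} ∅
  have h3 := norm_add_sq_le (ψ (((2 * N + r : ℕ) : ℤ), 0) - ψ (2 * N, 0))
    (ψ (2 * N, 0) - ψ (0, 0))
  rw [sub_add_sub_cancel] at h3
  have hL := half_le_log_two_add (r := ((2 * N + r : ℕ) : ℝ)) (by positivity)
  -- From `harmonic N ≤ 1 + log N` and `1 ≤ 2L`. The constant is then `52 = 16 · 3 + 4`, the 4
  -- coming from the possible last edge when `m` is odd.
  have hN : (harmonic N : ℝ) ≤ 3 * Real.log (2 + ((2 * N + r : ℕ) : ℝ)) := by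
    have a := harmonic_le_one_add_log N
    have b : Real.log N ≤ Real.log (2 + ((2 * N + r : ℕ) : ℝ)) := by
      rcases Nat.eq_zero_or_pos N with rfl | hN
      · simp only [Nat.cast_zero, Real.log_zero]; linarith
      · apply Real.log_le_log (by exact_mod_cast hN)
        have : (0 : ℝ) ≤ r := by positivity
        have : (0 : ℝ) ≤ N := by positivity
        push_cast; linarith
    linarith
  set L := Real.log (2 + ((2 * N + r : ℕ) : ℝ))
  have h4 : (harmonic N : ℝ) * B ≤ 3 * L * B := by gcongr
  have h5 : 1 / 2 * B ≤ L * B := by gcongr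
  nlinarith

theorem EnergyLe.norm_sub_int_sq_le {ψ : Z2 → 𝕜} {B : ℝ} (h : EnergyLe ψ B) (m : ℤ) :
    ‖ψ (m, 0) - ψ (0, 0)‖ ^ 2 ≤ 52 * Real.log (2 + |(m : ℝ)|) * B := by
  rcases le_total 0 m with hm | hm
  · lift m to ℕ using hm
    simpa using h.norm_sub_nat_sq_le m
  · obtain ⟨n, rfl⟩ : ∃ n : ℕ, m = -(n : ℤ) := ⟨(-m).toNat, by omega⟩
    simpa using h.reflect.norm_sub_nat_sq_le n

/-- The effective resistance between `0` and `x` grows at most logarithmically. -/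
theorem EnergyLe.norm_sub_sq_le {ψ : Z2 → 𝕜} {B : ℝ} (h : EnergyLe ψ B) (x : Z2) :
    ‖ψ x - ψ 0‖ ^ 2 ≤ 208 * Real.log (2 + eNorm x) * B := by
  have hB := h.nonneg
  have h1 := h.norm_sub_int_sq_le x.1
  -- Second leg of an L-shaped route through `(x.1, 0)`; `208 = 2 · (52 + 52)`.
  have h2 := ((h.translate (x.1, 0)).swap).norm_sub_int_sq_le x.2
  simp only [Prod.swap_prod_mk, Prod.mk_add_mk, zero_add, add_zero, Prod.mk.eta] at h2
  have h3 := norm_add_sq_le (ψ x - ψ (x.1, 0)) (ψ (x.1, 0) - ψ (0, 0))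
  rw [sub_add_sub_cancel] at h3
  have e1 : |(x.1 : ℝ)| ≤ eNorm x := Real.abs_le_sqrt (by nlinarith [sq_nonneg (x.2 : ℝ)])
  have e2 : |(x.2 : ℝ)| ≤ eNorm x := Real.abs_le_sqrt (by nlinarith [sq_nonneg (x.1 : ℝ)])
  have l1 : Real.log (2 + |(x.1 : ℝ)|) * B ≤ Real.log (2 + eNorm x) * B := by gcongr
  have l2 : Real.log (2 + |(x.2 : ℝ)|) * B ≤ Real.log (2 + eNorm x) * B := by gcongr
  change ‖ψ x - ψ (0, 0)‖ ^ 2 ≤ _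
  linarith

end Resistance

end LatticeSchrodinger

/-! ### Integrating the semigroup of a self-adjoint operator. -/

namespace LatticeSchrodinger

open MeasureTheory Filter
open scoped RealInnerProductSpace

section Semigroup

variable {F : Type*} [NormedAddCommGroup F] [InnerProductSpace ℝ F] [CompleteSpace F]

/-- If `⟪d, u⟫² ≤ K ⟪H u, u⟫` for all `u`, then `∫₀^∞ ⟪d, exp (-tH) d⟫ dt ≤ K`. -/
theorem integral_inner_exp_neg_le (H : F →L[ℝ] F) (hH : IsSelfAdjoint H) (d : F) (K : ℝ)
    (hK : ∀ u, ⟪d, u⟫ ^ 2 ≤ K * ⟪H u, u⟫) (hK0 : 0 ≤ K) :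
    IntegrableOn (fun t : ℝ => ⟪d, NormedSpace.exp (-(t • H)) d⟫) (Set.Ioi 0) ∧
      ∫ t in Set.Ioi (0 : ℝ), ⟪d, NormedSpace.exp (-(t • H)) d⟫ ≤ K := by
  set S : ℝ → F →L[ℝ] F := fun t => NormedSpace.exp (-(t • H)) with hS
  have hadj (t : ℝ) (u v : F) : ⟪S t u, v⟫ = ⟪u, S t v⟫ := by
    have h1 : IsSelfAdjoint (S t) := by
      have : IsSelfAdjoint (-(t • H)) := ((IsSelfAdjoint.all t).smul hH).neg
      rw [isSelfAdjoint_iff, hS, NormedSpace.star_exp, this.star_eq]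
    rw [← ContinuousLinearMap.adjoint_inner_right, h1.adjoint_eq]
  have hmul (s t : ℝ) : S (s + t) = S s * S t := by
    let _ : NormedAlgebra ℚ (F →L[ℝ] F) := NormedAlgebra.restrictScalars ℚ ℝ _
    simp only [hS]
    rw [← NormedSpace.exp_add_of_commute, add_smul, neg_add]
    exact (((Commute.refl H).smul_left s).smul_right t).neg_left.neg_right
  have hnn (t : ℝ) : 0 ≤ ⟪d, S t d⟫ := by
    have h : S t = S (t / 2) * S (t / 2) := by rw [← hmul, add_halves]
    rw [h, mul_apply_eq_comp, ← hadj]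
    exact real_inner_self_nonneg
  have hder (t : ℝ) : HasDerivAt (fun t => S t d) (-(H (S t d))) t := by
    have h1 := hasDerivAt_exp_smul_const' (𝕂 := ℝ) (-H) t
    have h2 := (ContinuousLinearMap.apply ℝ F d).hasFDerivAt.comp_hasDerivAt t h1
    simpa [hS, Function.comp_def] using h2
  have hcont : Continuous fun t => S t d :=
    continuous_iff_continuousAt.2 fun t => (hder t).continuousAt
  have hcont' : Continuous fun t => ⟪d, S t d⟫ := by fun_prop
  have hbound (T : ℝ) (hT : 0 ≤ T) : ∫ t in (0 : ℝ)..T, ⟪d, S t d⟫ ≤ K := by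
    set u : F := ∫ t in (0 : ℝ)..T, S t d with hu
    have hint : IntervalIntegrable (fun t => S t d) volume 0 T := hcont.intervalIntegrable _ _
    have hin (w : F) : ⟪w, u⟫ = ∫ t in (0 : ℝ)..T, ⟪w, S t d⟫ :=
      ((innerSL ℝ w).intervalIntegral_comp_comm hint).symm
    -- The integral of `-H S_t d` telescopes. The boundary term has a sign: `⟪S_T d, u⟫` is an
    -- integral of `⟪d, S_{T+t} d⟫ ≥ 0`, so dropping it only increases the energy bound.
    have hHu : H u = d - S T d := by
      have h1 := intervalIntegral.integral_eq_sub_of_hasDerivAt (a := 0) (b := T)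
        (fun t _ => hder t) ((H.continuous.comp hcont).neg.intervalIntegrable _ _)
      rw [intervalIntegral.integral_neg, H.intervalIntegral_comp_comm hint] at h1
      have h0 : S 0 d = d := by simp [hS]
      rw [h0] at h1
      rw [← neg_inj, h1, neg_sub]
    have h2 : 0 ≤ ⟪S T d, u⟫ := by
      rw [hin]
      refine intervalIntegral.integral_nonneg hT fun t _ => ?_
      rw [hadj, ← mul_apply_eq_comp, ← hmul]
      exact hnn _
    have h3 : ⟪H u, u⟫ ≤ ⟪d, u⟫ := by
      rw [hHu, inner_sub_left]; linarith
    have h4 := hK u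
    rw [← hin]
    have h5 : ⟪d, u⟫ ^ 2 ≤ K * ⟪d, u⟫ := h4.trans (mul_le_mul_of_nonneg_left h3 hK0)
    by_contra hlt
    push Not at hlt
    nlinarith
  have hI : IntegrableOn (fun t : ℝ => ⟪d, S t d⟫) (Set.Ioi 0) := by
    refine integrableOn_Ioi_of_intervalIntegral_norm_bounded (ι := ℝ) (l := atTop) (b := id) K 0
      (fun T => (hcont'.integrableOn_Icc (a := 0) (b := T)).mono_set Set.Ioc_subset_Icc_self)
      tendsto_id ?_
    filter_upwards [eventually_ge_atTop 0] with T hT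
    simpa only [Real.norm_of_nonneg (hnn _), id] using hbound T hT
  refine ⟨hI, ?_⟩
  refine le_of_tendsto (intervalIntegral_tendsto_integral_Ioi 0 hI tendsto_id) ?_
  filter_upwards [eventually_ge_atTop 0] with T hT using hbound T hT

end Semigroup

/-! ### Dirichlet energy on `ℓ²` and the Green function bound. -/

section Gradient

variable (𝕜 : Type) [RCLike 𝕜]

/-- The lattice gradient. -/
noncomputable def grad : L2 𝕜 Z2 →ₗ[𝕜] WithLp 2 (L2 𝕜 Z2 × L2 𝕜 Z2) :=
  (WithLp.linearEquiv 2 𝕜 _).symm.toLinearMap ∘ₗ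
    ((shift 𝕜 (1, 0) - 1).toLinearMap.prod (shift 𝕜 (0, 1) - 1).toLinearMap)

theorem norm_grad_sq (ψ : L2 𝕜 Z2) :
    ‖grad 𝕜 ψ‖ ^ 2 = ‖shift 𝕜 (1, 0) ψ - ψ‖ ^ 2 + ‖shift 𝕜 (0, 1) ψ - ψ‖ ^ 2 := by
  rw [WithLp.prod_norm_sq_eq_of_L2]
  rfl

variable {𝕜}

theorem inner_shift_left (e : Z2) (φ ψ : L2 𝕜 Z2) :
    inner 𝕜 (shift 𝕜 e φ) ψ = inner 𝕜 φ (shift 𝕜 (-e) ψ) := by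
  rw [lp.inner_eq_tsum, lp.inner_eq_tsum, ← (Equiv.addRight (-e)).tsum_eq]
  refine tsum_congr fun x => ?_
  simp [shift]

theorem inner_freeOp_left (φ ψ : L2 𝕜 Z2) :
    inner 𝕜 (freeOp 𝕜 φ) ψ = inner 𝕜 φ (freeOp 𝕜 ψ) := by
  simp only [freeOp, _root_.neg_apply, _root_.add_apply,
    _root_.sub_apply, one_apply_eq_self, inner_neg_left, inner_neg_right,
    inner_add_left, inner_add_right, inner_sub_left, inner_sub_right, inner_shift_left, Prod.neg_mk,
    neg_neg, neg_zero]
  ring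

theorem inner_grad (φ ψ : L2 𝕜 Z2) :
    inner 𝕜 (grad 𝕜 φ) (grad 𝕜 ψ) = inner 𝕜 φ (freeOp 𝕜 ψ) := by
  have h (e : Z2) : shift 𝕜 (-e) (shift 𝕜 e ψ) = ψ := by
    ext x; simp [shift]
  have h1 := h (1, 0)
  have h2 := h (0, 1)
  have e0 : inner 𝕜 (grad 𝕜 φ) (grad 𝕜 ψ) =
      inner 𝕜 (shift 𝕜 (1, 0) φ - φ) (shift 𝕜 (1, 0) ψ - ψ) +
      inner 𝕜 (shift 𝕜 (0, 1) φ - φ) (shift 𝕜 (0, 1) ψ - ψ) :=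
    WithLp.prod_inner_apply _ _
  rw [e0]
  simp only [freeOp, _root_.neg_apply, _root_.add_apply,
    _root_.sub_apply, one_apply_eq_self, inner_neg_right,
    inner_add_right, inner_sub_left, inner_sub_right, inner_shift_left, h1, h2]
  simp only [Prod.neg_mk, neg_zero]
  ring

theorem sum_norm_sq_le (ψ : L2 𝕜 Z2) (s : Finset Z2) : ∑ x ∈ s, ‖ψ x‖ ^ 2 ≤ ‖ψ‖ ^ 2 := by
  have := lp.sum_rpow_le_norm_rpow (p := 2) (by norm_num) ψ s
  simpa using this

theorem energyLe_norm_grad_sq (ψ : L2 𝕜 Z2) : EnergyLe ψ (‖grad 𝕜 ψ‖ ^ 2) := by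
  intro s t
  rw [norm_grad_sq]
  exact add_le_add (sum_norm_sq_le (shift 𝕜 (1, 0) ψ - ψ) s)
    (sum_norm_sq_le (shift 𝕜 (0, 1) ψ - ψ) t)

theorem norm_sq_le_of_apply_zero (ψ : L2 𝕜 Z2) (h0 : ψ 0 = 0) (x : Z2) :
    ‖ψ x‖ ^ 2 ≤ 208 * Real.log (2 + eNorm x) * ‖grad 𝕜 ψ‖ ^ 2 := by
  simpa [h0] using (energyLe_norm_grad_sq ψ).norm_sub_sq_le x

end Gradient

theorem log_two_add_eNorm_pos (x : Z2) : 0 < Real.log (2 + eNorm x) :=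
  lt_of_lt_of_le (by norm_num) (half_le_log_two_add (Real.sqrt_nonneg _))

theorem inner_dirichletOp_left (u v : L2 ℝ Punctured) :
    ⟪dirichletOp ℝ u, v⟫ = ⟪grad ℝ (extendOp ℝ u), grad ℝ (extendOp ℝ v)⟫ := by
  rw [inner_grad, ← inner_freeOp_left]
  exact (ContinuousLinearMap.adjoint_inner_right (restrictOp ℝ) _ _).symm

theorem integral_heatKernel_le (x : Z2) :
    IntegrableOn (fun t : ℝ => heatKernel t x x) (Set.Ioi 0) ∧
      ∫ t in Set.Ioi (0 : ℝ), heatKernel t x x ≤ 208 * Real.log (2 + eNorm x) := by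
  set d := restrictOp ℝ (lp.single 2 x (1 : ℝ)) with hd
  -- `d` is the point mass at `x`, or zero when `x = 0`; this identity covers both cases.
  have hdu (u : L2 ℝ Punctured) : ⟪d, u⟫ = extendOp ℝ u x := by
    rw [hd, ← ContinuousLinearMap.adjoint_inner_right, lp.inner_single_left]
    simp [extendOp]
  have hk (t : ℝ) : heatKernel t x x = ⟪d, NormedSpace.exp (-(t • dirichletOp ℝ)) d⟫ := by
    rw [hdu]; rfl
  simp only [hk]
  refine integral_inner_exp_neg_le _ ?_ d _ (fun u => ?_)
    (mul_nonneg (by norm_num) (log_two_add_eNorm_pos x).le)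
  · rw [ContinuousLinearMap.isSelfAdjoint_iff_isSymmetric]
    intro u v
    change ⟪dirichletOp ℝ u, v⟫ = ⟪u, dirichletOp ℝ v⟫
    rw [inner_dirichletOp_left, real_inner_comm, ← inner_dirichletOp_left, real_inner_comm]
  · rw [hdu, inner_dirichletOp_left, real_inner_self_eq_norm_sq]
    have h0 : extendOp ℝ u 0 = 0 := by simp [extendOp_apply]
    simpa using norm_sq_le_of_apply_zero (extendOp ℝ u) h0 x

end LatticeSchrodinger

/-! ### Dimension bound for subspaces with non-positive form. -/

namespace LatticeSchrodinger

open scoped ComplexConjugate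

/-- The weighted sum `∑ ln(2 + |x|) V(x)`. -/
noncomputable def logMass (V : Z2 → ℝ) : ENNReal :=
  ∑' x : Z2, ENNReal.ofReal (Real.log (2 + eNorm x) * V x)

/-- Evaluation at a lattice point. -/
def evalAt (x : Z2) : L2 ℂ Z2 →ₗ[ℂ] ℂ where
  toFun ψ := ψ x
  map_add' _ _ := rfl
  map_smul' _ _ := rfl

theorem eq_zero_of_grad_eq_zero {ψ : L2 ℂ Z2} (h0 : ψ 0 = 0) (hg : grad ℂ ψ = 0) : ψ = 0 := by
  ext x
  have := norm_sq_le_of_apply_zero ψ h0 x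
  rw [hg] at this
  simpa using this

/-- A Bessel inequality for evaluation at `x`, which is bounded in the energy norm on functions
vanishing at the origin. The test vector `ψ = ∑ conj(φ_i(x)) φ_i` has both `ψ(x)` and energy equal
to the sum `s`, so the resistance bound becomes `s² ≤ K s`. -/
theorem sum_norm_sq_le_of_orthonormal_grad {ι : Type*} [Fintype ι] (φ : ι → L2 ℂ Z2)
    (h0 : ∀ i, φ i 0 = 0) (hφ : Orthonormal ℂ fun i => grad ℂ (φ i)) (x : Z2) :
    ∑ i, ‖φ i x‖ ^ 2 ≤ 208 * Real.log (2 + eNorm x) := by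
  set s := ∑ i, ‖φ i x‖ ^ 2 with hs
  have hs0 : 0 ≤ s := by positivity
  set ψ : L2 ℂ Z2 := ∑ i, conj (φ i x) • φ i with hψ
  have hev (y : Z2) : ψ y = ∑ i, conj (φ i x) * φ i y := by
    change evalAt y ψ = _
    rw [hψ, map_sum]
    rfl
  have hx : ψ x = (s : ℂ) := by
    rw [hev, hs]
    push_cast
    exact Finset.sum_congr rfl fun i _ => RCLike.conj_mul _
  have hz : ψ 0 = 0 := by rw [hev]; simp [h0]
  have hg : ‖grad ℂ ψ‖ ^ 2 = s := by
    have h1 : grad ℂ ψ = ∑ i, conj (φ i x) • grad ℂ (φ i) := by simp [hψ]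
    have h2 := hφ.inner_sum (fun i => conj (φ i x)) (fun i => conj (φ i x)) Finset.univ
    rw [← h1, inner_self_eq_norm_sq_to_K] at h2
    have h3 : ((‖grad ℂ ψ‖ ^ 2 : ℝ) : ℂ) = (s : ℂ) := by
      push_cast
      refine Eq.trans h2 ?_
      rw [hs]
      push_cast
      refine Finset.sum_congr rfl fun i _ => ?_
      rw [RCLike.conj_mul]
      simp
    exact_mod_cast h3
  have h := norm_sq_le_of_apply_zero ψ hz x
  rw [hx, hg, Complex.norm_real, Real.norm_of_nonneg hs0] at h
  by_contra hlt
  push Not at hlt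
  have := log_two_add_eNorm_pos x
  nlinarith

/-- A space on which the quadratic form of `-Δ - V` is non-positive has dimension at most
`C ∑ ln(2 + |x|) V(x) + 1`. -/
theorem finrank_le_of_form_nonpos (V : Z2 → ℝ) (hV : ∀ x, 0 ≤ V x) (W : Submodule ℂ (L2 ℂ Z2))
    [FiniteDimensional ℂ W]
    (hW : ∀ ψ ∈ W, ENNReal.ofReal (‖grad ℂ ψ‖ ^ 2) ≤
      ∑' x, ENNReal.ofReal (V x * ‖ψ x‖ ^ 2)) :
    (Module.finrank ℂ W : ENNReal) ≤ ENNReal.ofReal 208 * logMass V + 1 := by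
  let e : W →ₗ[ℂ] ℂ := evalAt 0 ∘ₗ W.subtype
  let G : LinearMap.ker e →ₗ[ℂ] WithLp 2 (L2 ℂ Z2 × L2 ℂ Z2) :=
    grad ℂ ∘ₗ W.subtype ∘ₗ (LinearMap.ker e).subtype
  have hker : Module.finrank ℂ W ≤ Module.finrank ℂ (LinearMap.ker e) + 1 := by
    have h1 := e.finrank_range_add_finrank_ker
    have h2 : Module.finrank ℂ (LinearMap.range e) ≤ 1 := by
      simpa using Submodule.finrank_le (LinearMap.range e)
    omega
  have hGinj : Function.Injective G := by
    rw [← LinearMap.ker_eq_bot, LinearMap.ker_eq_bot']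
    intro m hm
    have h0 : (m.1.1 : L2 ℂ Z2) 0 = 0 := m.2
    exact Subtype.ext (Subtype.ext (eq_zero_of_grad_eq_zero h0 hm))
  have hGr : Module.finrank ℂ (LinearMap.range G) = Module.finrank ℂ (LinearMap.ker e) :=
    LinearMap.finrank_range_of_inj hGinj
  -- Pulling an orthonormal basis of the image back through the injective gradient gives a basis of
  -- the kernel of evaluation that is orthonormal in energy, not in `ℓ²`.
  let b := stdOrthonormalBasis ℂ (LinearMap.range G)
  choose φ hφ using fun i => (b i).2
  let ψ := fun i => ((φ i).1.1 : L2 ℂ Z2)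
  have h0 (i) : ψ i 0 = 0 := (φ i).2
  have hon : Orthonormal ℂ fun i => grad ℂ (ψ i) := by
    have := b.orthonormal.comp_linearIsometry (LinearMap.range G).subtypeₗᵢ
    refine (funext fun i => ?_ : (fun i => grad ℂ (ψ i)) = _) ▸ this
    exact hφ i
  have hm : (Module.finrank ℂ (LinearMap.ker e) : ENNReal) ≤ ENNReal.ofReal 208 * logMass V := by
    rw [← hGr]
    calc (Module.finrank ℂ (LinearMap.range G) : ENNReal)
        = ∑ i, ENNReal.ofReal (‖grad ℂ (ψ i)‖ ^ 2) := by simp [hon.1]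
      _ ≤ ∑ i, ∑' x, ENNReal.ofReal (V x * ‖ψ i x‖ ^ 2) :=
          Finset.sum_le_sum fun i _ => hW _ (φ i).1.2
      _ = ∑' x, ∑ i, ENNReal.ofReal (V x * ‖ψ i x‖ ^ 2) :=
          (Summable.tsum_finsetSum fun _ _ => ENNReal.summable).symm
      _ ≤ ∑' x, ENNReal.ofReal 208 * ENNReal.ofReal (Real.log (2 + eNorm x) * V x) := by
          refine ENNReal.tsum_le_tsum fun x => ?_
          rw [← ENNReal.ofReal_sum_of_nonneg fun i _ => mul_nonneg (hV x) (by positivity),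
            ← ENNReal.ofReal_mul (by norm_num), ← Finset.mul_sum]
          refine ENNReal.ofReal_le_ofReal ?_
          have := mul_le_mul_of_nonneg_left (sum_norm_sq_le_of_orthonormal_grad ψ h0 hon x) (hV x)
          linarith
      _ = _ := ENNReal.tsum_mul_left
  calc (Module.finrank ℂ W : ENNReal) ≤ (Module.finrank ℂ (LinearMap.ker e) : ENNReal) + 1 := by
        exact_mod_cast hker
    _ ≤ _ := by gcongr

/-! ### From eigenvectors to the form inequality, and the count. -/

section Eigen

variable {V : Z2 → ℝ}

/-- The eigenspace of `H` as a subspace of `ℓ²`. -/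
noncomputable def eigenspaceL2 (V : Z2 → ℝ) (E : ℝ) : Submodule ℂ (L2 ℂ Z2) :=
  (eigenspace V E).map (schrodinger V).domain.subtype

theorem rank_eigenspaceL2 (E : ℝ) :
    Module.rank ℂ (eigenspaceL2 V E) = Module.rank ℂ (eigenspace V E) :=
  (Submodule.equivMapOfInjective _ (Submodule.injective_subtype _) _).rank_eq.symm

theorem exists_mul_of_mem_eigenspaceL2 {E : ℝ} {ψ : L2 ℂ Z2} (h : ψ ∈ eigenspaceL2 V E) :
    ∃ η : L2 ℂ Z2, (∀ x, η x = V x * ψ x) ∧ freeOp ℂ ψ = (E : ℂ) • ψ + η := by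
  obtain ⟨χ, hχ, rfl⟩ := h
  refine ⟨⟨fun x => (V x : ℂ) * χ.1 x, χ.2⟩, fun x => rfl, ?_⟩
  ext x
  have := (mem_eigenspace V E χ).1 hχ x
  change -laplacian (⇑χ.1) x = (E : ℂ) * χ.1 x + (V x : ℂ) * χ.1 x
  linear_combination this

theorem inner_mul_left_eq {ψ₁ ψ₂ η₁ η₂ : L2 ℂ Z2} (h₁ : ∀ x, η₁ x = V x * ψ₁ x)
    (h₂ : ∀ x, η₂ x = V x * ψ₂ x) : inner ℂ η₁ ψ₂ = inner ℂ ψ₁ η₂ := by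
  rw [lp.inner_eq_tsum, lp.inner_eq_tsum]
  refine tsum_congr fun x => ?_
  rw [h₁, h₂]
  simp
  ring

theorem inner_eq_zero_of_mem_eigenspaceL2 {E₁ E₂ : ℝ} (hE : E₁ ≠ E₂) {ψ₁ ψ₂ : L2 ℂ Z2}
    (h₁ : ψ₁ ∈ eigenspaceL2 V E₁) (h₂ : ψ₂ ∈ eigenspaceL2 V E₂) : inner ℂ ψ₁ ψ₂ = 0 := by
  obtain ⟨η₁, hη₁, e₁⟩ := exists_mul_of_mem_eigenspaceL2 h₁
  obtain ⟨η₂, hη₂, e₂⟩ := exists_mul_of_mem_eigenspaceL2 h₂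
  have h := inner_freeOp_left ψ₁ ψ₂
  rw [e₁, e₂, inner_add_left, inner_add_right, inner_mul_left_eq hη₁ hη₂, inner_smul_left,
    inner_smul_right, Complex.conj_ofReal] at h
  have hne : (E₁ : ℂ) - E₂ ≠ 0 := sub_ne_zero.2 (by exact_mod_cast hE)
  refine (mul_eq_zero.1 ?_).resolve_left hne
  linear_combination h

/-- For `ψ = ∑ c_i v_i` orthonormality gives `‖∇ψ‖² = ∑ E_i |c_i|² + ∑ V|ψ|²`, and the first sum is
non-positive, so the dimension bound applies to the span. -/
theorem card_le_of_orthonormal_eigenvectors (hV : ∀ x, 0 ≤ V x) {ι : Type*} [Fintype ι]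
    (v : ι → L2 ℂ Z2) (hv : Orthonormal ℂ v) (E : ι → ℝ) (hE : ∀ i, E i ≤ 0)
    (hmem : ∀ i, v i ∈ eigenspaceL2 V (E i)) :
    (Fintype.card ι : ENNReal) ≤ ENNReal.ofReal 208 * logMass V + 1 := by
  rw [← finrank_span_eq_card hv.linearIndependent]
  have : FiniteDimensional ℂ (Submodule.span ℂ (Set.range v)) :=
    FiniteDimensional.span_of_finite ℂ (Set.finite_range v)
  refine finrank_le_of_form_nonpos V hV _ fun ψ hψ => ?_
  obtain ⟨c, rfl⟩ := (Submodule.mem_span_range_iff_exists_fun ℂ).1 hψ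
  choose η hη e using fun i => exists_mul_of_mem_eigenspaceL2 (hmem i)
  set ψ := ∑ i, c i • v i with hψdef
  set θ := ∑ i, c i • η i with hθdef
  have hθ (x : Z2) : θ x = V x * ψ x := by
    change evalAt x θ = V x * evalAt x ψ
    rw [hθdef, hψdef, map_sum, map_sum, Finset.mul_sum]
    refine Finset.sum_congr rfl fun i _ => ?_
    rw [map_smul, map_smul, smul_eq_mul, smul_eq_mul]
    change c i * η i x = V x * (c i * v i x)
    rw [hη]; ring
  have hH : freeOp ℂ ψ = (∑ i, ((E i : ℂ) * c i) • v i) + θ := by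
    rw [hψdef, hθdef, map_sum, ← Finset.sum_add_distrib]
    refine Finset.sum_congr rfl fun i _ => ?_
    rw [map_smul, e, smul_add, smul_smul, mul_comm]
  have hs : HasSum (fun x => V x * ‖ψ x‖ ^ 2) (inner ℂ ψ θ : ℂ).re := by
    have h1 := Complex.hasSum_re (lp.hasSum_inner ψ θ)
    convert h1 using 2 with x
    rw [hθ, RCLike.inner_apply, mul_assoc, RCLike.mul_conj]
    change _ = ((V x : ℂ) * ((‖ψ x‖ : ℝ) : ℂ) ^ 2).re
    rw [← Complex.ofReal_pow, Complex.re_ofReal_mul, Complex.ofReal_re]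
  have hg : ‖grad ℂ ψ‖ ^ 2 ≤ (inner ℂ ψ θ : ℂ).re := by
    have h1 := inner_grad ψ ψ
    rw [hH, inner_add_right, inner_self_eq_norm_sq_to_K] at h1
    have h2 := hv.inner_sum c (fun i => (E i : ℂ) * c i) Finset.univ
    rw [← hψdef] at h2
    rw [h2] at h1
    have h3 := congrArg Complex.re h1
    have h4 : ∑ i, conj (c i) * ((E i : ℂ) * c i) = ((∑ i, E i * ‖c i‖ ^ 2 : ℝ) : ℂ) := by
      push_cast
      refine Finset.sum_congr rfl fun i _ => ?_
      have := RCLike.conj_mul (c i)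
      simp only [Complex.coe_algebraMap] at this
      linear_combination (E i : ℂ) * this
    rw [h4, Complex.add_re, Complex.ofReal_re] at h3
    have h5 : ∑ i, E i * ‖c i‖ ^ 2 ≤ 0 :=
      Finset.sum_nonpos fun i _ => mul_nonpos_of_nonpos_of_nonneg (hE i) (by positivity)
    have h6 : (((‖grad ℂ ψ‖ : ℝ) : ℂ) ^ 2).re = ‖grad ℂ ψ‖ ^ 2 := by
      rw [← Complex.ofReal_pow, Complex.ofReal_re]
    have h7 := h6.symm.trans h3
    linarith
  rw [← ENNReal.ofReal_tsum_of_nonneg (fun x => mul_nonneg (hV x) (by positivity)) hs.summable,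
    hs.tsum_eq]
  exact ENNReal.ofReal_le_ofReal hg

theorem exists_submodule_finrank_eq {M : Type*} [AddCommGroup M] [Module ℂ M] (W : Submodule ℂ M)
    (n : ℕ) (hn : (n : Cardinal) ≤ Module.rank ℂ W) :
    ∃ F ≤ W, FiniteDimensional ℂ F ∧ Module.finrank ℂ F = n := by
  obtain ⟨v, hv⟩ := Module.le_rank_iff.1 hn
  have hv' := hv.map' W.subtype (Submodule.ker_subtype W)
  refine ⟨Submodule.span ℂ (Set.range (W.subtype ∘ v)), ?_,
    FiniteDimensional.span_of_finite ℂ (Set.finite_range _), ?_⟩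
  · rw [Submodule.span_le]
    rintro _ ⟨i, rfl⟩
    exact (v i).2
  · rw [finrank_span_eq_card hv', Fintype.card_fin]

/-- Orthonormal families chosen in different eigenspaces combine into one, by symmetry of `H`.
Taking `n E` only as a lower bound for the rank leaves room for infinite-dimensional eigenspaces. -/
theorem sum_le_of_le_rank (hV : ∀ x, 0 ≤ V x) (s : Finset (Set.Iic (0 : ℝ)))
    (n : Set.Iic (0 : ℝ) → ℕ)
    (hn : ∀ E ∈ s, (n E : Cardinal) ≤ Module.rank ℂ (eigenspace V E)) :
    ((∑ E ∈ s, n E : ℕ) : ENNReal) ≤ ENNReal.ofReal 208 * logMass V + 1 := by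
  have hF (E : s) : ∃ F ≤ eigenspaceL2 V E.1, FiniteDimensional ℂ F ∧
      Module.finrank ℂ F = n E.1 :=
    exists_submodule_finrank_eq _ _ (by rw [rank_eigenspaceL2]; exact hn E.1 E.2)
  choose F hFle hFd hFn using hF
  let v : (Σ E : s, Fin (Module.finrank ℂ (F E))) → L2 ℂ Z2 :=
    fun p => (stdOrthonormalBasis ℂ (F p.1) p.2 : L2 ℂ Z2)
  have hv : Orthonormal ℂ v := by
    constructor
    · intro p
      exact (stdOrthonormalBasis ℂ (F p.1)).orthonormal.1 p.2
    · rintro ⟨E₁, i₁⟩ ⟨E₂, i₂⟩ hne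
      by_cases h : E₁ = E₂
      · subst h
        exact (stdOrthonormalBasis ℂ (F E₁)).orthonormal.2 fun h => hne (congrArg _ h)
      · exact inner_eq_zero_of_mem_eigenspaceL2 (fun h' => h (Subtype.ext (Subtype.ext h')))
          (hFle _ (Subtype.prop _)) (hFle _ (Subtype.prop _))
  have := card_le_of_orthonormal_eigenvectors hV v hv (fun p => p.1.1.1) (fun p => p.1.1.2)
    (fun p => hFle _ (Subtype.prop _))
  rw [Fintype.card_sigma] at this
  simp only [Fintype.card_fin, hFn] at this
  rwa [← Finset.sum_coe_sort]

theorem numNonpos_le (hV : ∀ x, 0 ≤ V x) :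
    numNonpos V ≤ ENNReal.ofReal 208 * logMass V + 1 := by
  rw [numNonpos, ENNReal.tsum_eq_iSup_sum]
  refine iSup_le fun s => ?_
  by_cases hfin : ∀ E ∈ s, Module.rank ℂ (eigenspace V E) < Cardinal.aleph0
  · have := sum_le_of_le_rank hV s (fun E => (Module.rank ℂ (eigenspace V E)).toNat)
      (fun E hE => (Cardinal.cast_toNat_of_lt_aleph0 (hfin E hE)).le)
    refine le_trans (le_of_eq ?_) this
    push_cast
    refine Finset.sum_congr rfl fun E hE => ?_
    conv_lhs => rw [← Cardinal.cast_toNat_of_lt_aleph0 (hfin E hE)]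
    simp
  · push Not at hfin
    obtain ⟨E, -, hE⟩ := hfin
    -- An infinite-dimensional eigenspace contains subspaces of every finite dimension, which forces
    -- the right-hand side to be infinite.
    have h (n : ℕ) : (n : ENNReal) ≤ ENNReal.ofReal 208 * logMass V + 1 := by
      simpa using sum_le_of_le_rank hV {E} (fun _ => n)
        (fun E' hE' => by
          rw [Finset.mem_singleton.1 hE']
          exact (Cardinal.natCast_lt_aleph0).le.trans hE)
    rw [ENNReal.eq_top_of_forall_nnreal_le (x := ENNReal.ofReal 208 * logMass V + 1)]
    · exact le_top
    · intro r
      obtain ⟨n, hn⟩ := exists_nat_ge r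
      exact le_trans (by exact_mod_cast hn) (h n)

end Eigen

end LatticeSchrodinger

theorem mainTheorem3 :
    ∃ C : ℝ, 0 < C ∧
      (∀ x : Z2,
        MeasureTheory.IntegrableOn (fun t : ℝ => heatKernel t x x) (Set.Ioi 0) ∧
        ∫ t in Set.Ioi (0 : ℝ), heatKernel t x x ≤ C * Real.log (2 + eNorm x)) ∧
      (∀ V : Z2 → ℝ, (∀ x, 0 ≤ V x) →
        numNonpos V ≤
          ENNReal.ofReal C * ∑' x : Z2, ENNReal.ofReal (Real.log (2 + eNorm x) * V x) + 1) :=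
  ⟨208, by norm_num, integral_heatKernel_le, fun _ hV => numNonpos_le hV⟩
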